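/- **Theorem (exponential convergence of Kinodynamic EST).** *Setting.* Let $X$ be a finite-dimensional real normed space with Lebesgue (Haar) measure $\mu$, let $U$ be a set of controls, $F\subseteq X$ the free space, $B(x)\subseteq U$ the controls admissible at $x$, and $D:X\times U\to X$ the dynamics. A trajectory on $[0,S]$ is a pair $y:[0,S]\to X$, $u:[0,S]\to U$ with $y(s)\in F$, $u(s)\in B(y(s))$ and $y'(s)=D(y(s),u(s))$ for all $s\in[0,S]$. Let $R(p)$ be the set of end points of finite concatenations of trajectories starting at $p$, and let $R_\ell(p)\subseteq R(p)$ be the set of states reached from $p$ with a piecewise-constant control having at most $\ell$ constant pieces, each of duration at most $h\in[0,\infty]$. For $S\subseteq X$ let $R(S)=\bigcup_{p\in S}R(p)$ and $R_\ell(S)=\bigcup_{p\in S}R_\ell(p)$. Assume that $\{(p,q): q\in R_\ell(p)\}$ is measurable. The $\beta$-lookout of $S$ is $\{p\in S:\mu(R_\ell(p)\setminus S)\ge\beta\,\mu(R(S)\setminus S)\}$. The free space is *$(\alpha,\beta)$-expansive*, where $\alpha,\beta\in(0,1]$, if for every $p\in F$ and every measurable connected $S\subseteq R(p)$ the $\beta$-lookout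 of $S$ has volume at least $\alpha\,\mu(S)$. Kinodynamic EST with uniform sampling, started at $x_I\in F$, generates random milestones $m_0=x_I,m_1,m_2,\dots$ such that, conditionally on $m_0,\dots,m_i$, the milestone $m_{i+1}$ is uniformly distributed on $R_\ell(\{m_0,\dots,m_i\})$ (these sets are understood to have positive volume, so that this makes sense). Each sample takes constant time $\tau>0$, and the planner succeeds as soon as a milestone lies in the measurable goal region $G$; its running time is $T=\tau\cdot\inf\{i:m_i\in G\}$. Let $f(t)=P(T>t)$ be the probability that it fails given time $t$, and let $g=\mu(G\cap R(x_I))$ be the volume of the reachable goal region. *Claim.* Let $\alpha,\beta\in(0,1]$, $V\in\mathbb R$, $\tau>0$ and $g_1<1$. There are positive constants $\gamma,\delta,C,g_0$, depending only on these numbers and on $(X,\mu,U)$, such that, for every free space $F$ with $B,D,h,\ell$ as above that is $(\alpha,\beta)$-expansive, every $x_I\in F$ with $\mu(R(x_I))\le V$, and every measurable goal region $G$ with $g>0$: 1. if $g\le g_1$, then $f(t)\le\gamma\,\ln\frac1g\;e^{-\delta g t}$ for all $t\ge0$; 2. if $g\le g_0$, then $E[T]\le C\,\frac1g\,\ln\ln\frac1g$;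 that is, $E[T]=O\!\left(\frac1g\ln\ln\frac1g\right)$ as $g\to0$. -/

import Mathlib

open MeasureTheory ProbabilityTheory
open scoped ENNReal

/-- The data shared by all kinodynamic planning problems in one space: the free space `F`
(kinematic constraints), the admissible controls `B x` at a state `x`, and the dynamics
`y' = D y u`. A start state and a goal region are supplied separately. -/
structure KinodynamicSpace (X U : Type*) where
  F : Set X
  B : X → Set U
  D : X → U → X

namespace KinodynamicSpace

variable {X U : Type*} [NormedAddCommGroup X] [NormedSpace ℝ X]

/-- `y : [0, S] → X` with control `u : [0, S] → U` satisfies the kinematic constraints, the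
control constraints and the dynamic equation at every time of `[0, S]`. -/
def IsTrajectory (K : KinodynamicSpace X U) (S : ℝ) (y : ℝ → X) (u : ℝ → U) : Prop :=
  0 ≤ S ∧ ∀ s ∈ Set.Icc 0 S,
    y s ∈ K.F ∧ u s ∈ K.B (y s) ∧ HasDerivWithinAt y (K.D (y s) (u s)) (Set.Icc 0 S) s

/-- Some trajectory leads from `p` to `q`. -/
def Joins (K : KinodynamicSpace X U) (p q : X) : Prop :=
  ∃ (S : ℝ) (y : ℝ → X) (u : ℝ → U), K.IsTrajectory S y u ∧ y 0 = p ∧ y S = q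

/-- The reachability set `R(p)`: the end points of finite concatenations of trajectories starting
at `p`. The control may jump at finitely many times, as piecewise-constant controls do. -/
def reach (K : KinodynamicSpace X U) (p : X) : Set X :=
  {q | Relation.ReflTransGen K.Joins p q}

/-- The reachability set `R(S)` of a set: the union of the `R(p)` for `p ∈ S`. -/
def reachSet (K : KinodynamicSpace X U) (S : Set X) : Set X :=
  ⋃ p ∈ S, K.reach p

/-- Some trajectory with a constant control and of duration at most `h` leads from `p` to `q`. -/
def ConstJoins (K : KinodynamicSpace X U) (h : ℝ≥0∞) (p q : X) : Prop :=
  ∃ (S : ℝ) (y : ℝ → X) (c : U),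
    ENNReal.ofReal S ≤ h ∧ K.IsTrajectory S y (fun _ => c) ∧ y 0 = p ∧ y S = q

/-- The local (`ℓ`-)reachability set `R_ℓ(p)`: the states reached from `p` by a
piecewise-constant control with at most `ℓ` constant pieces, each of duration at most `h`. -/
def localReach (K : KinodynamicSpace X U) (h : ℝ≥0∞) : ℕ → X → Set X
  | 0, p => {p}
  | k + 1, p => K.localReach h k p ∪ {q | ∃ r ∈ K.localReach h k p, K.ConstJoins h r q}

variable [MeasurableSpace X]

/-- The `b`-lookout of `S`: the points of `S` whose local reachability set covers, outside `S`,
at least the fraction `b` of the volume that `S` can reach outside itself. -/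
def lookout (K : KinodynamicSpace X U) (μ : Measure X) (h : ℝ≥0∞) (l : ℕ) (b : ℝ)
    (S : Set X) : Set X :=
  {p | p ∈ S ∧ ENNReal.ofReal b * μ (K.reachSet S \ S) ≤ μ (K.localReach h l p \ S)}

/-- The free space is `(a, b)`-expansive: for every free state `p`, every (measurable) connected
subset `S` of `R(p)` has a `b`-lookout of volume at least `a` times the volume of `S`. -/
def IsExpansive (K : KinodynamicSpace X U) (μ : Measure X) (h : ℝ≥0∞) (l : ℕ) (a b : ℝ) :
    Prop :=
  ∀ p ∈ K.F, ∀ S ⊆ K.reach p, MeasurableSet S → IsConnected S →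
    ENNReal.ofReal a * μ S ≤ μ (K.lookout μ h l b S)

/-- `m 0, m 1, m 2, …` are the milestones of a run of Kinodynamic EST with uniform sampling from
`xI`: the tree starts as the single milestone `m 0 = xI`, and the conditional law of the next
milestone `m (i + 1)`, given the milestones `m 0, …, m i` already in the tree, is the uniform
distribution on the local reachability set `⋃ j ≤ i, R_ℓ(m j)` of the tree. -/
structure IsESTRun (K : KinodynamicSpace X U) (μ : Measure X) (h : ℝ≥0∞) (l : ℕ) (xI : X)
    {Ω : Type*} [MeasurableSpace Ω] (P : Measure Ω) (m : ℕ → Ω → X) : Prop where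
  measurable : ∀ i, Measurable (m i)
  init : ∀ᵐ ω ∂P, m 0 ω = xI
  step : ∀ (i : ℕ) (A : Set (Fin (i + 1) → X)) (E : Set X), MeasurableSet A → MeasurableSet E →
    P {ω | (fun j : Fin (i + 1) => m j ω) ∈ A ∧ m (i + 1) ω ∈ E} =
      ∫⁻ ω in {ω | (fun j : Fin (i + 1) => m j ω) ∈ A},
        (μ[|⋃ j : Fin (i + 1), K.localReach h l (m j ω)]) E ∂P

end KinodynamicSpace

/-- The running time of the planner when drawing one milestone takes time `τ`: it stops at the
first milestone that lies in the goal region `G` (and the time is `∞` if there is none). -/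
noncomputable def planningTime {X Ω : Type*} (τ : ℝ) (G : Set X) (m : ℕ → Ω → X) (ω : Ω) :
    ℝ≥0∞ :=
  ENNReal.ofReal τ * ⨅ (i : ℕ) (_ : m i ω ∈ G), (i : ℝ≥0∞)

/-- A planner with random running time `T` satisfies the exponential convergence bound with
constants `a` and `b`: the probability `f(t)` that it has not succeeded after time `t` is at most
`a * exp (-b t)`. -/
def ExponentialConvergenceBound {Ω : Type*} [MeasurableSpace Ω] (P : Measure Ω) (T : Ω → ℝ≥0∞)
    (a b : ℝ) : Prop :=
  ∀ t : ℝ, 0 ≤ t → P.real {ω | ENNReal.ofReal t < T ω} ≤ a * Real.exp (-b * t)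

/-! Let T be the local reachability set of the current tree. Every milestone lies in the previous T,
so T stays a connected subset of R(x_I) containing x_I, and hence R(T) = R(x_I). By expansiveness a
uniform sample of T lies in the β-lookout with probability at least α, and then covers at least a
fraction β of R(x_I) \ T. So the mean uncovered volume e_n is at most V (1 - αβ)^n
(`lintegral_uncovered_succ_add_le`).

Let f_n be the probability that m_0, …, m_n all miss G. A uniform sample of T hits G with
probability at least (g - μ(R(x_I) \ T)) / V, whence g f_n ≤ V (f_n - f_{n+1}) + e_n
(`mul_measure_failure_le`). Solving this recurrence gives f_n ≤ A (1 - d g)^n with A and d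
independent of g (`measureReal_failure_le`).

This is stronger than the claim: no logarithm is needed. The factors ln(1/g) and ln ln(1/g) enter
only because they are bounded below on the stated ranges of g. -/

namespace KinodynamicSpace

/-! ### Reachability sets and their connectedness -/

section Reachability

variable {X U : Type*} [NormedAddCommGroup X] [NormedSpace ℝ X]
  {K : KinodynamicSpace X U} {h : ℝ≥0∞} {p q : X}

theorem ConstJoins.joins (hpq : K.ConstJoins h p q) : K.Joins p q := by
  obtain ⟨S, y, c, -, hy, h0, hS⟩ := hpq
  exact ⟨S, y, _, hy, h0, hS⟩

theorem self_mem_localReach (l : ℕ) (p : X) : p ∈ K.localReach h l p := by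
  induction l with
  | zero => exact rfl
  | succ k ih => exact Or.inl ih

theorem localReach_subset_reach (l : ℕ) (p : X) : K.localReach h l p ⊆ K.reach p := by
  induction l with
  | zero =>
    rintro q rfl
    exact Relation.ReflTransGen.refl
  | succ k ih =>
    rintro q (hq | ⟨r, hr, hrq⟩)
    · exact ih hq
    · exact Relation.ReflTransGen.tail (ih hr) hrq.joins

theorem reach_subset_reach (hq : q ∈ K.reach p) : K.reach q ⊆ K.reach p :=
  fun _ hr => Relation.ReflTransGen.trans hq hr

theorem reachSet_eq_reach {S : Set X} (hS : S ⊆ K.reach p) (hp : p ∈ S) :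
    K.reachSet S = K.reach p := by
  refine Set.Subset.antisymm (Set.iUnion₂_subset fun q hq => reach_subset_reach (hS hq)) ?_
  exact Set.subset_biUnion_of_mem (u := fun q => K.reach q) hp

theorem IsTrajectory.mono {S s : ℝ} {y : ℝ → X} {u : ℝ → U} (hy : K.IsTrajectory S y u)
    (hs0 : 0 ≤ s) (hs : s ≤ S) : K.IsTrajectory s y u := by
  have hsub : Set.Icc 0 s ⊆ Set.Icc 0 S := Set.Icc_subset_Icc_right hs
  exact ⟨hs0, fun t ht => ⟨(hy.2 t (hsub ht)).1, (hy.2 t (hsub ht)).2.1,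
    (hy.2 t (hsub ht)).2.2.mono hsub⟩⟩

/-- The path itself is the connected set: stopping a constant control early keeps it constant and
only shortens its duration. -/
theorem ConstJoins.exists_isPreconnected (hpq : K.ConstJoins h p q) :
    ∃ t ⊆ {r | K.ConstJoins h p r}, p ∈ t ∧ q ∈ t ∧ IsPreconnected t := by
  obtain ⟨S, y, c, hSh, hy, rfl, rfl⟩ := hpq
  refine ⟨y '' Set.Icc 0 S, ?_, ⟨0, ⟨le_rfl, hy.1⟩, rfl⟩, ⟨S, ⟨hy.1, le_rfl⟩, rfl⟩,
    isPreconnected_Icc.image y fun s hs => (hy.2 s hs).2.2.continuousWithinAt⟩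
  rintro _ ⟨s, hs, rfl⟩
  exact ⟨s, y, c, (ENNReal.ofReal_le_ofReal hs.2).trans hSh, hy.mono hs.1 hs.2, rfl, rfl⟩

theorem isConnected_localReach (l : ℕ) (p : X) : IsConnected (K.localReach h l p) := by
  refine ⟨⟨p, self_mem_localReach l p⟩, ?_⟩
  induction l with
  | zero => exact isPreconnected_singleton
  | succ k ih =>
    refine isPreconnected_of_forall p ?_
    rintro q (hq | ⟨r, hr, hrq⟩)
    · exact ⟨_, Set.subset_union_left, self_mem_localReach k p, hq, ih⟩
    · obtain ⟨t, hts, hrt, hqt, ht⟩ := hrq.exists_isPreconnected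
      refine ⟨K.localReach h k p ∪ t, ?_, Or.inl (self_mem_localReach k p), Or.inr hqt,
        ih.union r hr hrt ht⟩
      exact Set.union_subset_union_right _ fun x hx => ⟨r, hr, hts hx⟩

end Reachability

/-- The local reachability set `R_ℓ({y 0, …, y (i - 1)})` of a finite family of milestones. -/
def treeReach {X U : Type*} [NormedAddCommGroup X] [NormedSpace ℝ X]
    (K : KinodynamicSpace X U) (h : ℝ≥0∞) (l : ℕ) {i : ℕ} (y : Fin i → X) : Set X :=
  ⋃ j, K.localReach h l (y j)

/-! ### The region reached by the tree -/

section Tree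

variable {X U : Type*} [NormedAddCommGroup X] [NormedSpace ℝ X]
  {K : KinodynamicSpace X U} {h : ℝ≥0∞} {l : ℕ} {p : X}

theorem treeReach_succ (x : ℕ → X) (i : ℕ) :
    K.treeReach h l (fun j : Fin (i + 1) => x j) =
      K.treeReach h l (fun j : Fin i => x j) ∪ K.localReach h l (x i) := by
  ext q
  simp only [treeReach, Set.mem_iUnion, Set.mem_union, Fin.exists_fin_succ', Fin.val_castSucc,
    Fin.val_last]

theorem treeReach_subset_reach_and_isConnected {x : ℕ → X} (h0 : x 0 = p)
    (hx : ∀ i, x (i + 1) ∈ K.treeReach h l (fun j : Fin (i + 1) => x j)) (i : ℕ) :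
    K.treeReach h l (fun j : Fin (i + 1) => x j) ⊆ K.reach p ∧
      IsConnected (K.treeReach h l (fun j : Fin (i + 1) => x j)) ∧
      p ∈ K.treeReach h l (fun j : Fin (i + 1) => x j) := by
  induction i with
  | zero =>
    have : K.treeReach h l (fun j : Fin (0 + 1) => x j) = K.localReach h l p := by
      rw [treeReach_succ, h0]
      simp [treeReach]
    rw [this]
    exact ⟨localReach_subset_reach l p, isConnected_localReach l p, self_mem_localReach l p⟩
  | succ i ih =>
    rw [treeReach_succ]
    refine ⟨Set.union_subset ih.1 ?_, ?_, Or.inl ih.2.2⟩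
    · exact (localReach_subset_reach l _).trans (reach_subset_reach (ih.1 (hx i)))
    · exact ih.2.1.union ⟨x (i + 1), hx i, self_mem_localReach l _⟩ (isConnected_localReach l _)

theorem measurableSet_treeReach_graph [MeasurableSpace X]
    (hK : MeasurableSet {pq : X × X | pq.2 ∈ K.localReach h l pq.1}) (i : ℕ) :
    MeasurableSet {yq : (Fin i → X) × X | yq.2 ∈ K.treeReach h l yq.1} := by
  have : {yq : (Fin i → X) × X | yq.2 ∈ K.treeReach h l yq.1} =
      ⋃ j, (fun yq : (Fin i → X) × X => (yq.1 j, yq.2)) ⁻¹'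
        {pq : X × X | pq.2 ∈ K.localReach h l pq.1} := by
    ext yq
    simp [treeReach]
  rw [this]
  exact MeasurableSet.iUnion fun j => hK.preimage (by fun_prop)

end Tree

end KinodynamicSpace

/-! ### Uniform sampling as a kernel -/

section UniformKernel

variable {Y X Ω : Type*} [MeasurableSpace Y] [MeasurableSpace X] [MeasurableSpace Ω]

theorem measurable_measure_section (μ : Measure X) [SFinite μ] {W : Y → Set X}
    (hW : MeasurableSet {p : Y × X | p.2 ∈ W p.1}) : Measurable fun y => μ (W y) :=
  measurable_measure_prodMk_left hW

/-- The kernel that sends `y` to the uniform distribution on the section `W y`. -/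
noncomputable def uniformKernel (μ : Measure X) [SFinite μ] (W : Y → Set X)
    (hW : MeasurableSet {p : Y × X | p.2 ∈ W p.1}) : Kernel Y X where
  toFun y := μ[|W y]
  measurable' := by
    refine Measure.measurable_of_measurable_coe _ fun E hE => ?_
    have hWy : ∀ y, MeasurableSet (W y) := fun y => measurable_prodMk_left hW
    simp only [cond_apply (hWy _)]
    refine (measurable_measure_section μ hW).inv.mul ?_
    exact measurable_measure_section μ (W := fun y => W y ∩ E)
      (hW.inter (measurable_snd hE))

/-- Only finiteness holds: on a section of volume zero or infinity the conditional measure is the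
zero measure. -/
instance isFiniteKernel_uniformKernel (μ : Measure X) [SFinite μ] (W : Y → Set X)
    (hW : MeasurableSet {p : Y × X | p.2 ∈ W p.1}) : IsFiniteKernel (uniformKernel μ W hW) :=
  ⟨1, ENNReal.one_lt_top, fun y => by
    change (μ[|W y]) Set.univ ≤ 1
    simp only [ProbabilityTheory.cond, Measure.smul_apply, Measure.restrict_apply_univ, smul_eq_mul]
    exact ENNReal.inv_mul_le_one _⟩

/-- Rectangles determine the joint law, which is therefore the composition-product of the law of `H`
with `κ`. -/
theorem lintegral_pair_eq_of_rectangles {P : Measure Ω} [IsProbabilityMeasure P]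
    {H : Ω → Y} {Z : Ω → X} (hH : Measurable H) (hZ : Measurable Z) (κ : Kernel Y X)
    [IsFiniteKernel κ]
    (hstep : ∀ A E, MeasurableSet A → MeasurableSet E →
      P {ω | H ω ∈ A ∧ Z ω ∈ E} = ∫⁻ ω in {ω | H ω ∈ A}, κ (H ω) E ∂P)
    {f : Y × X → ℝ≥0∞} (hf : Measurable f) :
    ∫⁻ ω, f (H ω, Z ω) ∂P = ∫⁻ ω, ∫⁻ x, f (H ω, x) ∂κ (H ω) ∂P := by
  have hmap : P.map (fun ω => (H ω, Z ω)) = (P.map H) ⊗ₘ κ := by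
    have := Measure.isProbabilityMeasure_map (μ := P) hH.aemeasurable
    have := Measure.isProbabilityMeasure_map (μ := P) (hH.prodMk hZ).aemeasurable
    refine Measure.ext_prod fun {A E} hA hE => ?_
    rw [Measure.map_apply (hH.prodMk hZ) (hA.prod hE), Measure.compProd_apply_prod hA hE,
      setLIntegral_map hA (κ.measurable_coe hE) hH]
    exact hstep A E hA hE
  rw [← lintegral_map hf (hH.prodMk hZ), hmap, Measure.lintegral_compProd hf,
    lintegral_map (Measurable.lintegral_kernel_prod_right' hf) hH]

end UniformKernel

/-! ### One step of the planner: covered volume and hits of the goal -/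

namespace KinodynamicSpace

variable {X U Ω : Type*} [NormedAddCommGroup X] [NormedSpace ℝ X] [MeasurableSpace X]
  {K : KinodynamicSpace X U} {μ : Measure X} {h : ℝ≥0∞} {l : ℕ} {xI : X}
  [MeasurableSpace Ω] {P : Measure Ω} {m : ℕ → Ω → X}

theorem measurableSet_treeReach
    (hK : MeasurableSet {pq : X × X | pq.2 ∈ K.localReach h l pq.1}) {i : ℕ} (y : Fin i → X) :
    MeasurableSet (K.treeReach h l y) :=
  measurable_prodMk_left (measurableSet_treeReach_graph hK i)

/-- The volume of `R` that the tree of the first `i + 1` milestones does not cover. -/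
noncomputable def uncovered (K : KinodynamicSpace X U) (μ : Measure X) (h : ℝ≥0∞) (l : ℕ)
    (R : Set X) (m : ℕ → Ω → X) (i : ℕ) (ω : Ω) : ℝ≥0∞ :=
  μ R - μ (K.treeReach h l fun j : Fin (i + 1) => m j ω)

namespace IsESTRun

theorem measurable_history (hrun : K.IsESTRun μ h l xI P m) (i : ℕ) :
    Measurable fun ω => fun j : Fin (i + 1) => m j ω :=
  measurable_pi_lambda _ fun j => hrun.measurable j

theorem measurable_uncovered [SFinite μ]
    (hK : MeasurableSet {pq : X × X | pq.2 ∈ K.localReach h l pq.1})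
    (hrun : K.IsESTRun μ h l xI P m) (R : Set X) (i : ℕ) :
    Measurable (K.uncovered μ h l R m i) :=
  ((measurable_measure_section μ (measurableSet_treeReach_graph hK (i + 1))).comp
    (hrun.measurable_history i)).const_sub _

theorem lintegral_step [SFinite μ] [IsProbabilityMeasure P]
    (hK : MeasurableSet {pq : X × X | pq.2 ∈ K.localReach h l pq.1})
    (hrun : K.IsESTRun μ h l xI P m) (i : ℕ)
    {f : (Fin (i + 1) → X) × X → ℝ≥0∞} (hf : Measurable f) :
    ∫⁻ ω, f (fun j : Fin (i + 1) => m j ω, m (i + 1) ω) ∂P =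
      ∫⁻ ω, ∫⁻ x, f (fun j : Fin (i + 1) => m j ω, x)
        ∂(μ[|K.treeReach h l fun j : Fin (i + 1) => m j ω]) ∂P :=
  lintegral_pair_eq_of_rectangles (hrun.measurable_history i) (hrun.measurable (i + 1))
    (uniformKernel μ _ (measurableSet_treeReach_graph hK (i + 1))) (hrun.step i) hf

theorem ae_mem_treeReach [SFinite μ] [IsProbabilityMeasure P]
    (hK : MeasurableSet {pq : X × X | pq.2 ∈ K.localReach h l pq.1})
    (hrun : K.IsESTRun μ h l xI P m) :
    ∀ᵐ ω ∂P, ∀ i, m (i + 1) ω ∈ K.treeReach h l fun j : Fin (i + 1) => m j ω := by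
  refine ae_all_iff.2 fun i => ?_
  have hgr := measurableSet_treeReach_graph hK (i + 1)
  have hf : Measurable ({yq : (Fin (i + 1) → X) × X | yq.2 ∈ K.treeReach h l yq.1}ᶜ.indicator
      (1 : (Fin (i + 1) → X) × X → ℝ≥0∞)) := measurable_one.indicator hgr.compl
  have key := hrun.lintegral_step hK i hf
  have hzero : ∀ ω, ∫⁻ x, {yq : (Fin (i + 1) → X) × X | yq.2 ∈ K.treeReach h l yq.1}ᶜ.indicator
      (1 : (Fin (i + 1) → X) × X → ℝ≥0∞) (fun j : Fin (i + 1) => m j ω, x)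
        ∂(μ[|K.treeReach h l fun j : Fin (i + 1) => m j ω]) = 0 := by
    intro ω
    refine (lintegral_congr_ae ?_).trans lintegral_zero
    filter_upwards [ae_cond_mem (measurableSet_treeReach hK fun j : Fin (i + 1) => m j ω)]
      with x hx
    simpa using hx
  simp only [hzero, lintegral_zero] at key
  replace key := (lintegral_eq_zero_iff
    (hf.comp ((hrun.measurable_history i).prodMk (hrun.measurable (i + 1))))).1 key
  filter_upwards [key] with ω hω
  by_contra hmem
  simp [hmem] at hω

/-- Positive volume is forced by the step law: taken on the whole space, it says that the
conditional measure has mean total mass 1, whereas this mass is at most 1 and vanishes on a null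
set. -/
theorem ae_measure_treeReach_ne_zero [SFinite μ] [IsProbabilityMeasure P]
    (hK : MeasurableSet {pq : X × X | pq.2 ∈ K.localReach h l pq.1})
    (hrun : K.IsESTRun μ h l xI P m) :
    ∀ᵐ ω ∂P, ∀ i, μ (K.treeReach h l fun j : Fin (i + 1) => m j ω) ≠ 0 := by
  refine ae_all_iff.2 fun i => ?_
  set k : Ω → ℝ≥0∞ := fun ω => (μ[|K.treeReach h l fun j : Fin (i + 1) => m j ω]) Set.univ
  have hkm : Measurable k :=
    ((uniformKernel μ _ (measurableSet_treeReach_graph hK (i + 1))).measurable_coe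
      MeasurableSet.univ).comp (hrun.measurable_history i)
  have hk1 : ∀ ω, k ω ≤ 1 := fun ω => by
    simp only [k, ProbabilityTheory.cond, Measure.smul_apply, Measure.restrict_apply_univ,
      smul_eq_mul]
    exact ENNReal.inv_mul_le_one _
  have hint : ∫⁻ ω, k ω ∂P = 1 := by
    have := hrun.step i Set.univ Set.univ MeasurableSet.univ MeasurableSet.univ
    simp only [Set.mem_univ, and_self, Set.ofPred_true, measure_univ, Measure.restrict_univ] at this
    exact this.symm
  have hsub : ∫⁻ ω, (1 - k ω) ∂P = 0 := by
    rw [lintegral_sub hkm (by simp [hint]) (Filter.Eventually.of_forall hk1), hint]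
    simp
  rw [lintegral_eq_zero_iff (hkm.const_sub 1)] at hsub
  filter_upwards [hsub] with ω hω hnull
  have : k ω = 0 := by
    simp only [k, cond_eq_zero_of_meas_eq_zero hnull, Measure.coe_zero, Pi.zero_apply]
  simp [this] at hω

theorem ae_treeReach [SFinite μ] [IsProbabilityMeasure P]
    (hK : MeasurableSet {pq : X × X | pq.2 ∈ K.localReach h l pq.1})
    (hrun : K.IsESTRun μ h l xI P m) :
    ∀ᵐ ω ∂P, ∀ i, K.treeReach h l (fun j : Fin (i + 1) => m j ω) ⊆ K.reach xI ∧
      IsConnected (K.treeReach h l fun j : Fin (i + 1) => m j ω) ∧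
      xI ∈ K.treeReach h l fun j : Fin (i + 1) => m j ω := by
  filter_upwards [hrun.init, hrun.ae_mem_treeReach hK] with ω h0 hmem
  exact treeReach_subset_reach_and_isConnected (x := fun j => m j ω) h0 hmem

theorem ae_uncovered_eq [SFinite μ] [IsProbabilityMeasure P]
    (hK : MeasurableSet {pq : X × X | pq.2 ∈ K.localReach h l pq.1})
    (hrun : K.IsESTRun μ h l xI P m) (hR : μ (K.reach xI) ≠ ∞) :
    ∀ᵐ ω ∂P, ∀ i, K.uncovered μ h l (K.reach xI) m i ω =
      μ (K.reach xI \ K.treeReach h l fun j : Fin (i + 1) => m j ω) := by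
  filter_upwards [hrun.ae_treeReach hK] with ω hω i
  exact (measure_sdiff (hω i).1 (measurableSet_treeReach hK _).nullMeasurableSet
    (measure_ne_top_of_subset (hω i).1 hR)).symm

/-- Adding a milestone to the tree covers, in the mean, at least the fraction `a * b` of the
reachable volume not covered so far. -/
theorem lintegral_uncovered_succ_add_le [SFinite μ] [IsProbabilityMeasure P] {a b : ℝ}
    (hexp : K.IsExpansive μ h l a b) (hxI : xI ∈ K.F)
    (hK : MeasurableSet {pq : X × X | pq.2 ∈ K.localReach h l pq.1})
    (hrun : K.IsESTRun μ h l xI P m) (hR : μ (K.reach xI) ≠ ∞) (i : ℕ) :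
    ∫⁻ ω, K.uncovered μ h l (K.reach xI) m (i + 1) ω ∂P +
      ENNReal.ofReal a * ENNReal.ofReal b * ∫⁻ ω, K.uncovered μ h l (K.reach xI) m i ω ∂P ≤
        ∫⁻ ω, K.uncovered μ h l (K.reach xI) m i ω ∂P := by
  have hφset : MeasurableSet {z : ((Fin (i + 1) → X) × X) × X |
      z.2 ∈ K.localReach h l z.1.2 \ K.treeReach h l z.1.1} := by
    refine MeasurableSet.diff (s₁ := {z : ((Fin (i + 1) → X) × X) × X |
      z.2 ∈ K.localReach h l z.1.2}) (s₂ := {z : ((Fin (i + 1) → X) × X) × X |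
      z.2 ∈ K.treeReach h l z.1.1}) ?_ ?_
    · exact hK.preimage
        (f := fun z : ((Fin (i + 1) → X) × X) × X => (z.1.2, z.2)) (by fun_prop)
    · exact (measurableSet_treeReach_graph hK (i + 1)).preimage
        (f := fun z : ((Fin (i + 1) → X) × X) × X => (z.1.1, z.2)) (by fun_prop)
  have hφ : Measurable fun z : (Fin (i + 1) → X) × X =>
      μ (K.localReach h l z.2 \ K.treeReach h l z.1) :=
    measurable_measure_section μ hφset
  have hlow : ENNReal.ofReal a * ENNReal.ofReal b *
      ∫⁻ ω, K.uncovered μ h l (K.reach xI) m i ω ∂P ≤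
      ∫⁻ ω, μ (K.localReach h l (m (i + 1) ω) \
        K.treeReach h l fun j : Fin (i + 1) => m j ω) ∂P := by
    rw [hrun.lintegral_step hK i hφ,
      ← lintegral_const_mul _ (hrun.measurable_uncovered hK _ i)]
    refine lintegral_mono_ae ?_
    filter_upwards [hrun.ae_treeReach hK, hrun.ae_uncovered_eq hK hR,
      hrun.ae_measure_treeReach_ne_zero hK] with ω hω hunc hpos
    rw [hunc i]
    obtain ⟨hsub, hconn, hmem⟩ := hω i
    have hpos := hpos i
    set T := K.treeReach h l fun j : Fin (i + 1) => m j ω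
    have hT : MeasurableSet T := measurableSet_treeReach hK _
    have hTfin : μ T ≠ ∞ := measure_ne_top_of_subset hsub hR
    -- The lookout of T has volume at least `a * μ T`; dividing by `μ T` makes this a probability.
    have hlook : ENNReal.ofReal a ≤
        μ[|T] {x | ENNReal.ofReal b * μ (K.reach xI \ T) ≤ μ (K.localReach h l x \ T)} := by
      have hL := hexp xI hxI T hsub hT hconn
      rw [cond_apply hT, ← ENNReal.div_eq_inv_mul, ENNReal.le_div_iff_mul_le (Or.inl hpos)
        (Or.inl hTfin)]
      refine hL.trans (measure_mono fun x hx => ⟨hx.1, ?_⟩)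
      have := hx.2
      rwa [reachSet_eq_reach hsub hmem] at this
    -- Markov's inequality for the newly covered volume.
    calc ENNReal.ofReal a * ENNReal.ofReal b * μ (K.reach xI \ T)
        = ENNReal.ofReal b * μ (K.reach xI \ T) * ENNReal.ofReal a := by ring
      _ ≤ ENNReal.ofReal b * μ (K.reach xI \ T) *
          μ[|T] {x | ENNReal.ofReal b * μ (K.reach xI \ T) ≤ μ (K.localReach h l x \ T)} := by
        gcongr
      _ ≤ ∫⁻ x, μ (K.localReach h l x \ T) ∂μ[|T] :=
        mul_meas_ge_le_lintegral (hφ.comp measurable_prodMk_left) _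
  -- What remains is pointwise bookkeeping: the volume of L \ T is exactly the drop in the uncovered
  -- volume.
  refine (add_le_add_right hlow _).trans ?_
  rw [← lintegral_add_left (hrun.measurable_uncovered hK _ (i + 1))]
  refine lintegral_mono_ae ?_
  filter_upwards [hrun.ae_treeReach hK] with ω hω
  have hsub := (hω (i + 1)).1
  simp only [uncovered]
  rw [treeReach_succ (fun j => m j ω) (i + 1)] at hsub ⊢
  set T := K.treeReach h l fun j : Fin (i + 1) => m j ω
  set L := K.localReach h l (m (i + 1) ω)
  have hT : MeasurableSet T := measurableSet_treeReach hK _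
  have hadd : μ (T ∪ L) = μ T + μ (L \ T) := by
    rw [← Set.union_sdiff_self, measure_union' Set.disjoint_sdiff_right hT]
  have hle : μ (T ∪ L) ≤ μ (K.reach xI) := measure_mono hsub
  have hTfin : μ T ≠ ∞ := measure_ne_top_of_subset (Set.subset_union_left.trans hsub) hR
  refine ENNReal.le_sub_of_add_le_right hTfin ?_
  calc μ (K.reach xI) - μ (T ∪ L) + μ (L \ T) + μ T
      = μ (K.reach xI) - μ (T ∪ L) + μ (T ∪ L) := by rw [hadd]; ring
    _ = μ (K.reach xI) := tsub_add_cancel_of_le hle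
    _ ≤ _ := le_rfl

/-- As long as no milestone lies in the goal, the next one does so with probability at least the
fraction of the reachable volume filled by the covered part of the reachable goal. -/
theorem mul_measure_failure_le [SFinite μ] [IsProbabilityMeasure P] {G : Set X}
    (hG : MeasurableSet G)
    (hK : MeasurableSet {pq : X × X | pq.2 ∈ K.localReach h l pq.1})
    (hrun : K.IsESTRun μ h l xI P m) (hR : μ (K.reach xI) ≠ ∞) (i : ℕ) :
    μ (G ∩ K.reach xI) * P {ω | ∀ j ≤ i, m j ω ∉ G} ≤
      μ (K.reach xI) * P {ω | (∀ j ≤ i, m j ω ∉ G) ∧ m (i + 1) ω ∈ G} +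
        ∫⁻ ω, K.uncovered μ h l (K.reach xI) m i ω ∂P := by
  have hA : MeasurableSet {y : Fin (i + 1) → X | ∀ j, y j ∉ G} := by
    rw [Set.ofPred_forall]
    exact MeasurableSet.iInter fun j => hG.compl.preimage (measurable_pi_apply j)
  have hN : {ω | ∀ j ≤ i, m j ω ∉ G} =
      {ω | (fun j : Fin (i + 1) => m j ω) ∈ {y : Fin (i + 1) → X | ∀ j, y j ∉ G}} := by
    ext ω
    simp only [Set.mem_ofPred_eq, Fin.forall_iff, Nat.lt_succ_iff]
  have hstep := hrun.step i _ G hA hG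
  have hset : {ω | (∀ j ≤ i, m j ω ∉ G) ∧ m (i + 1) ω ∈ G} =
      {ω | (fun j : Fin (i + 1) => m j ω) ∈ {y : Fin (i + 1) → X | ∀ j, y j ∉ G} ∧
        m (i + 1) ω ∈ G} := by
    ext ω
    simp only [Set.mem_ofPred_eq, Fin.forall_iff, Nat.lt_succ_iff]
  rw [hset, hstep, hN]
  set N := {ω | (fun j : Fin (i + 1) => m j ω) ∈ {y : Fin (i + 1) → X | ∀ j, y j ∉ G}}
  have hκ : Measurable fun ω => (μ[|⋃ j : Fin (i + 1), K.localReach h l (m j ω)]) G :=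
    ((uniformKernel μ _ (measurableSet_treeReach_graph hK (i + 1))).measurable_coe
      hG).comp (hrun.measurable_history i)
  rw [← setLIntegral_const, ← lintegral_const_mul _ hκ]
  refine le_trans ?_ (add_le_add_right (setLIntegral_le_lintegral N _) _)
  rw [← lintegral_add_left (hκ.const_mul _)]
  refine lintegral_mono_ae (ae_restrict_of_ae ?_)
  filter_upwards [hrun.ae_treeReach hK, hrun.ae_uncovered_eq hK hR,
    hrun.ae_measure_treeReach_ne_zero hK] with ω hω hunc hpos
  rw [hunc i]
  have hsub := (hω i).1
  have hpos := hpos i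
  change _ ≤ μ (K.reach xI) * (μ[|K.treeReach h l fun j : Fin (i + 1) => m j ω]) G + _
  set T := K.treeReach h l fun j : Fin (i + 1) => m j ω
  have hT : MeasurableSet T := measurableSet_treeReach hK _
  -- A reachable goal point is either covered by T, and so can be sampled, or still uncovered.
  calc μ (G ∩ K.reach xI) ≤ μ ((T ∩ G) ∪ (K.reach xI \ T)) := by
        refine measure_mono fun x hx => ?_
        by_cases hxT : x ∈ T
        · exact Or.inl ⟨hxT, hx.1⟩
        · exact Or.inr ⟨hx.2, hxT⟩
    _ ≤ μ (T ∩ G) + μ (K.reach xI \ T) := measure_union_le _ _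
    _ = μ T * μ[|T] G + μ (K.reach xI \ T) := by
        rw [cond_apply hT, ← mul_assoc,
          ENNReal.mul_inv_cancel hpos (measure_ne_top_of_subset hsub hR), one_mul]
    _ ≤ _ := by gcongr

end IsESTRun

end KinodynamicSpace

/-- With B = 1 / (r - q), the subtracted term B q^n absorbs the forcing term: advancing the bound by
one step leaves the surplus (B (r - q) - 1) q^n, which is zero. -/
theorem le_sub_geometric_of_recurrence {f e : ℕ → ℝ} {q r V g : ℝ} (hV : 0 < V) (hq : q < r)
    (hr0 : 0 ≤ r) (hr : 1 - g / V ≤ r) (hf : ∀ n, 0 ≤ f n) (hf0 : f 0 ≤ 1) (he : ∀ n, e n ≤ V * q ^ n)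
    (hfe : ∀ n, g * f n ≤ V * (f n - f (n + 1)) + e n) (n : ℕ) :
    f n ≤ (1 + 1 / (r - q)) * r ^ n - 1 / (r - q) * q ^ n := by
  have hB : 1 / (r - q) * (r - q) = 1 := one_div_mul_cancel (sub_pos.2 hq).ne'
  set B := 1 / (r - q)
  induction n with
  | zero => simpa using hf0
  | succ n ih =>
    have h1 : V * f (n + 1) ≤ V * ((1 - g / V) * f n + q ^ n) := by
      have : V * ((1 - g / V) * f n + q ^ n) = V * f n - g * f n + V * q ^ n := by
        field_simp
      linarith [hfe n, he n]
    have h2 : f (n + 1) ≤ (1 - g / V) * f n + q ^ n := le_of_mul_le_mul_left h1 hV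
    have hr' : (1 - g / V) * f n ≤ r * f n := mul_le_mul_of_nonneg_right hr (hf n)
    have hfr : r * f n ≤ r * ((1 + B) * r ^ n - B * q ^ n) :=
      mul_le_mul_of_nonneg_left ih hr0
    calc f (n + 1) ≤ r * ((1 + B) * r ^ n - B * q ^ n) + q ^ n := by linarith
      _ = (1 + B) * r ^ (n + 1) - B * q ^ (n + 1) - (B * (r - q) - 1) * q ^ n := by ring
      _ = _ := by rw [hB]; ring

/-! ### Geometric decay of the failure probability -/

namespace KinodynamicSpace.IsESTRun

variable {X U Ω : Type*} [NormedAddCommGroup X] [NormedSpace ℝ X] [MeasurableSpace X]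
  {K : KinodynamicSpace X U} {μ : Measure X} {h : ℝ≥0∞} {l : ℕ} {xI : X}
  [MeasurableSpace Ω] {P : Measure Ω} {m : ℕ → Ω → X}

theorem lintegral_uncovered_le [IsProbabilityMeasure P] (R : Set X) (i : ℕ) :
    ∫⁻ ω, K.uncovered μ h l R m i ω ∂P ≤ μ R := by
  refine (lintegral_mono fun ω => tsub_le_self).trans ?_
  simp

theorem toReal_lintegral_uncovered_le [SFinite μ] [IsProbabilityMeasure P] {a b V : ℝ}
    (ha : 0 < a) (ha1 : a ≤ 1) (hb : 0 < b) (hb1 : b ≤ 1) (hV : 0 < V)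
    (hexp : K.IsExpansive μ h l a b) (hxI : xI ∈ K.F)
    (hK : MeasurableSet {pq : X × X | pq.2 ∈ K.localReach h l pq.1})
    (hrun : K.IsESTRun μ h l xI P m) (hR : μ (K.reach xI) ≤ ENNReal.ofReal V) (i : ℕ) :
    (∫⁻ ω, K.uncovered μ h l (K.reach xI) m i ω ∂P).toReal ≤ V * (1 - a * b) ^ i := by
  have hRtop : μ (K.reach xI) ≠ ∞ := (hR.trans_lt ENNReal.ofReal_lt_top).ne
  have hfin : ∀ i, ∫⁻ ω, K.uncovered μ h l (K.reach xI) m i ω ∂P ≠ ∞ := fun i =>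
    ((lintegral_uncovered_le _ i).trans_lt hRtop.lt_top).ne
  induction i with
  | zero =>
    rw [pow_zero, mul_one]
    exact ENNReal.toReal_le_of_le_ofReal hV.le ((lintegral_uncovered_le _ 0).trans hR)
  | succ i ih =>
    have hstep := ENNReal.toReal_mono (hfin i)
      (hrun.lintegral_uncovered_succ_add_le hexp hxI hK hRtop i)
    rw [ENNReal.toReal_add (hfin _) (ENNReal.mul_ne_top (by finiteness) (hfin i)),
      ENNReal.toReal_mul, ENNReal.toReal_mul, ENNReal.toReal_ofReal ha.le,
      ENNReal.toReal_ofReal hb.le] at hstep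
    have hab : a * b ≤ 1 := mul_le_one₀ ha1 hb.le hb1
    calc _ ≤ (1 - a * b) * (∫⁻ ω, K.uncovered μ h l (K.reach xI) m i ω ∂P).toReal := by linarith
      _ ≤ (1 - a * b) * (V * (1 - a * b) ^ i) :=
        mul_le_mul_of_nonneg_left ih (sub_nonneg.2 hab)
      _ = _ := by ring

/-- The probability that none of the first `n + 1` milestones lies in the goal decays
exponentially in `n` times the volume of the reachable goal. -/
theorem measureReal_failure_le [SFinite μ] [IsProbabilityMeasure P] {a b V g : ℝ}
    (ha : 0 < a) (ha1 : a ≤ 1) (hb : 0 < b) (hb1 : b ≤ 1) (hV : 0 < V) {G : Set X}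
    (hexp : K.IsExpansive μ h l a b) (hxI : xI ∈ K.F)
    (hK : MeasurableSet {pq : X × X | pq.2 ∈ K.localReach h l pq.1})
    (hG : MeasurableSet G)
    (hrun : K.IsESTRun μ h l xI P m) (hR : μ (K.reach xI) ≤ ENNReal.ofReal V)
    (hg : g = (μ (G ∩ K.reach xI)).toReal) (n : ℕ) :
    a * b / (2 * V) * g ≤ 1 / 2 ∧ P.real {ω | ∀ j ≤ n, m j ω ∉ G} ≤
      (1 + 2 / (a * b)) * (1 - a * b / (2 * V) * g) ^ n := by
  have hRtop : μ (K.reach xI) ≠ ∞ := (hR.trans_lt ENNReal.ofReal_lt_top).ne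
  have hab0 : 0 < a * b := mul_pos ha hb
  have hab : a * b ≤ 1 := mul_le_one₀ ha1 hb.le hb1
  have hg0 : 0 ≤ g := hg ▸ ENNReal.toReal_nonneg
  have hgV : g ≤ V := by
    rw [hg]
    exact ENNReal.toReal_le_of_le_ofReal hV.le ((measure_mono Set.inter_subset_right).trans hR)
  have hgV' : g / V ≤ 1 := (div_le_one hV).2 hgV
  have hgV0 : 0 ≤ g / V := div_nonneg hg0 hV.le
  have hrw : a * b / (2 * V) * g = a * b / 2 * (g / V) := by field_simp
  have hd : a * b / 2 * (g / V) ≤ a * b / 2 := mul_le_of_le_one_right (by positivity) hgV'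
  rw [hrw]
  refine ⟨by linarith, ?_⟩
  -- The factor ab/2 slows the rate 1 - g/V so that r exceeds 1 - ab by at least ab/2 for every g ≤
  -- V; this keeps the prefactor independent of g.
  set r := 1 - a * b / 2 * (g / V)
  have hr1 : 1 - g / V ≤ r := by
    have : a * b / 2 * (g / V) ≤ g / V := mul_le_of_le_one_left hgV0 (by linarith)
    simp only [r]
    linarith
  have hrq : a * b / 2 ≤ r - (1 - a * b) := by simp only [r]; linarith
  have hr0 : 0 ≤ r := by simp only [r]; linarith
  have hmeas : ∀ n, MeasurableSet {ω | m (n + 1) ω ∈ G} := fun n => hrun.measurable (n + 1) hG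
  have hrec : ∀ n, g * P.real {ω | ∀ j ≤ n, m j ω ∉ G} ≤
      V * (P.real {ω | ∀ j ≤ n, m j ω ∉ G} - P.real {ω | ∀ j ≤ n + 1, m j ω ∉ G}) +
        (∫⁻ ω, K.uncovered μ h l (K.reach xI) m n ω ∂P).toReal := by
    intro n
    have hfin : ∫⁻ ω, K.uncovered μ h l (K.reach xI) m n ω ∂P ≠ ∞ :=
      ((lintegral_uncovered_le _ n).trans_lt hRtop.lt_top).ne
    have key := ENNReal.toReal_mono (by finiteness) ((hrun.mul_measure_failure_le hG hK hRtop n).trans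
      (add_le_add_left (mul_le_mul_left hR _) _))
    rw [ENNReal.toReal_add (by finiteness) hfin, ENNReal.toReal_mul, ENNReal.toReal_mul,
      ENNReal.toReal_ofReal hV.le, ← hg] at key
    have hsplit := measureReal_inter_add_sdiff (μ := P)
      (s := {ω | ∀ j ≤ n, m j ω ∉ G}) (hmeas n)
    have hsucc : {ω | ∀ j ≤ n, m j ω ∉ G} \ {ω | m (n + 1) ω ∈ G} =
        {ω | ∀ j ≤ n + 1, m j ω ∉ G} := by
      ext ω
      simp only [Set.mem_sdiff, Set.mem_ofPred_eq, Nat.le_succ_iff, or_imp, forall_and, forall_eq]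
    rw [hsucc] at hsplit
    rw [← hsplit, add_sub_cancel_right, hsplit]
    exact key
  have hbound := le_sub_geometric_of_recurrence hV (by linarith : 1 - a * b < r) hr0 hr1
    (fun n => measureReal_nonneg) measureReal_le_one
    (fun n => hrun.toReal_lintegral_uncovered_le ha ha1 hb hb1 hV hexp hxI hK hR n) hrec n
  have hB : 1 / (r - (1 - a * b)) ≤ 2 / (a * b) := by
    rw [div_le_div_iff₀ (by linarith) hab0]
    linarith
  have hB0 : 0 ≤ 1 / (r - (1 - a * b)) * (1 - a * b) ^ n :=
    mul_nonneg (by apply one_div_nonneg.2; linarith) (pow_nonneg (by linarith) n)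
  calc _ ≤ (1 + 1 / (r - (1 - a * b))) * r ^ n := by linarith
    _ ≤ _ := by gcongr

end KinodynamicSpace.IsESTRun

/-! ### From the number of milestones to the running time -/

section PlanningTime

variable {X Ω : Type*} {τ : ℝ} {G : Set X} {m : ℕ → Ω → X}

theorem forall_notMem_of_lt_planningTime (hτ : 0 < τ) {t : ℝ} (ht : 0 ≤ t) {ω : Ω}
    (hω : ENNReal.ofReal t < planningTime τ G m ω) : ∀ j ≤ ⌊t / τ⌋₊, m j ω ∉ G := by
  intro j hj hmem
  refine hω.not_ge ?_
  calc planningTime τ G m ω ≤ ENNReal.ofReal τ * (j : ℝ≥0∞) := by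
        unfold planningTime
        gcongr
        exact iInf₂_le j hmem
    _ = ENNReal.ofReal (τ * j) := by rw [ENNReal.ofReal_mul hτ.le, ENNReal.ofReal_natCast]
    _ ≤ ENNReal.ofReal t := by
        refine ENNReal.ofReal_le_ofReal ?_
        have := (Nat.le_floor_iff (div_nonneg ht hτ.le)).1 hj
        rwa [le_div_iff₀ hτ, mul_comm] at this

/-- The index of the first hit is the number of n for which m_0, …, m_n all miss G; without a hit
the sum is infinite. -/
theorem planningTime_le_tsum (ω : Ω) :
    planningTime τ G m ω ≤
      ENNReal.ofReal τ * ∑' n : ℕ, {ω | ∀ j ≤ n, m j ω ∉ G}.indicator 1 ω := by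
  classical
  unfold planningTime
  gcongr
  by_cases hex : ∃ i, m i ω ∈ G
  · calc (⨅ (i : ℕ) (_ : m i ω ∈ G), (i : ℝ≥0∞)) ≤ (Nat.find hex : ℝ≥0∞) :=
          iInf₂_le (f := fun (i : ℕ) (_ : m i ω ∈ G) => (i : ℝ≥0∞)) _ (Nat.find_spec hex)
      _ = ∑ n ∈ Finset.range (Nat.find hex), {ω | ∀ j ≤ n, m j ω ∉ G}.indicator 1 ω := by
          rw [Finset.sum_congr rfl (g := fun _ => (1 : ℝ≥0∞))]
          · simp
          · intro n hn
            exact Set.indicator_of_mem (s := {ω | ∀ j ≤ n, m j ω ∉ G}) (fun j hj =>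
              Nat.find_min hex (hj.trans_lt (Finset.mem_range.1 hn))) _
      _ ≤ _ := ENNReal.sum_le_tsum _
  · have hall : ∀ n : ℕ, {ω | ∀ j ≤ n, m j ω ∉ G}.indicator (1 : Ω → ℝ≥0∞) ω = 1 := fun n =>
      Set.indicator_of_mem (s := {ω | ∀ j ≤ n, m j ω ∉ G})
        (fun j _ hj => hex ⟨j, hj⟩) _
    simp [hall]

variable [MeasurableSpace Ω] {P : Measure Ω} [IsProbabilityMeasure P]
  {A d : ℝ}

/-- The factor e pays for rounding t/τ down to an integer, a loss of at most exp d with d ≤ 1. -/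
theorem exponentialConvergenceBound_of_geometric (hτ : 0 < τ) (hA : 0 ≤ A) (hd0 : 0 ≤ d)
    (hd1 : d ≤ 1)
    (hP : ∀ n, P.real {ω | ∀ j ≤ n, m j ω ∉ G} ≤ A * (1 - d) ^ n) :
    ExponentialConvergenceBound P (planningTime τ G m) (A * Real.exp 1) (d / τ) := by
  intro t ht
  set n := ⌊t / τ⌋₊
  have hn : t / τ < n + 1 := Nat.lt_floor_add_one _
  calc P.real {ω | ENNReal.ofReal t < planningTime τ G m ω}
      ≤ P.real {ω | ∀ j ≤ n, m j ω ∉ G} :=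
        measureReal_mono fun ω hω => forall_notMem_of_lt_planningTime hτ ht hω
    _ ≤ A * (1 - d) ^ n := hP n
    _ ≤ A * Real.exp (-d) ^ n := by
        gcongr
        exact Real.one_sub_le_exp_neg d
    _ = A * Real.exp (n * -d) := by rw [← Real.exp_nat_mul]
    _ ≤ A * Real.exp (1 + -(d / τ) * t) := by
        gcongr
        have h1 : d * (t / τ) ≤ d * (n + 1) := by gcongr
        have h2 : d / τ * t = d * (t / τ) := by ring
        linarith
    _ = A * Real.exp 1 * Real.exp (-(d / τ) * t) := by rw [Real.exp_add]; ring

theorem lintegral_planningTime_le_of_geometric [MeasurableSpace X] (hG : MeasurableSet G)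
    (hm : ∀ i, Measurable (m i)) (hτ : 0 < τ) (hA : 0 ≤ A) (hd0 : 0 < d) (hd1 : d ≤ 1)
    (hP : ∀ n, P.real {ω | ∀ j ≤ n, m j ω ∉ G} ≤ A * (1 - d) ^ n) :
    ∫⁻ ω, planningTime τ G m ω ∂P ≤ ENNReal.ofReal (τ * A / d) := by
  have hmeas : ∀ n : ℕ, MeasurableSet {ω | ∀ j ≤ n, m j ω ∉ G} := by
    intro n
    simp only [Set.ofPred_forall]
    exact MeasurableSet.iInter fun j => MeasurableSet.iInter fun _ => (hm j hG).compl
  calc ∫⁻ ω, planningTime τ G m ω ∂P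
      ≤ ∫⁻ ω, ENNReal.ofReal τ * ∑' n : ℕ, {ω | ∀ j ≤ n, m j ω ∉ G}.indicator 1 ω ∂P :=
        lintegral_mono fun ω => planningTime_le_tsum ω
    _ = ENNReal.ofReal τ * ∑' n : ℕ, P {ω | ∀ j ≤ n, m j ω ∉ G} := by
        rw [lintegral_const_mul' _ _ ENNReal.ofReal_ne_top,
          lintegral_tsum fun n => (measurable_one.indicator (hmeas n)).aemeasurable]
        simp only [lintegral_indicator_one (hmeas _)]
    _ ≤ ENNReal.ofReal τ * ∑' n : ℕ, ENNReal.ofReal (A * (1 - d) ^ n) := by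
        gcongr with n
        exact (ofReal_measureReal (measure_ne_top P _)).symm.trans_le
          (ENNReal.ofReal_le_ofReal (hP n))
    _ = ENNReal.ofReal (τ * A / d) := by
        have hsum := (hasSum_geometric_of_lt_one (sub_nonneg.2 hd1)
          (by linarith : 1 - d < 1)).mul_left A
        rw [← ENNReal.ofReal_tsum_of_nonneg
          (fun n => mul_nonneg hA (pow_nonneg (sub_nonneg.2 hd1) n)) hsum.summable, hsum.tsum_eq,
          ← ENNReal.ofReal_mul hτ.le]
        congr 1
        rw [sub_sub_cancel]
        ring

end PlanningTime

theorem mainTheorem6 {X U : Type*} [NormedAddCommGroup X] [NormedSpace ℝ X]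
    [FiniteDimensional ℝ X] [MeasurableSpace X] [BorelSpace X]
    (μ : Measure X) [μ.IsAddHaarMeasure]
    (α β : ℝ) (hα : 0 < α) (hα1 : α ≤ 1) (hβ : 0 < β) (hβ1 : β ≤ 1)
    (V : ℝ) (τ : ℝ) (hτ : 0 < τ) (g₁ : ℝ) (hg₁ : g₁ < 1) :
    ∃ γ > (0 : ℝ), ∃ δ > (0 : ℝ), ∃ C > (0 : ℝ), ∃ g₀ > (0 : ℝ),
      ∀ (K : KinodynamicSpace X U) (h : ℝ≥0∞) (l : ℕ) (xI : X) (G : Set X),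
        K.IsExpansive μ h l α β →
        MeasurableSet {pq : X × X | pq.2 ∈ K.localReach h l pq.1} →
        xI ∈ K.F →
        μ (K.reach xI) ≤ ENNReal.ofReal V →
        MeasurableSet G →
        ∀ (Ω : Type*) [MeasurableSpace Ω] (P : Measure Ω) [IsProbabilityMeasure P]
          (m : ℕ → Ω → X), K.IsESTRun μ h l xI P m →
        ∀ g : ℝ, g = (μ (G ∩ K.reach xI)).toReal → 0 < g →
          (g ≤ g₁ →
            ExponentialConvergenceBound P (planningTime τ G m)
              (γ * Real.log (1 / g)) (δ * g)) ∧
          (g ≤ g₀ →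
            ∫⁻ ω, planningTime τ G m ω ∂P ≤
              ENNReal.ofReal (C * (1 / g * Real.log (Real.log (1 / g))))) := by
  have hαβ : 0 < α * β := mul_pos hα hβ
  -- The constants are chosen before any problem is given, and V may be nonpositive.
  set W := max V 1
  have hW : 0 < W := lt_max_of_lt_right one_pos
  set d := α * β / (2 * W)
  have hd : 0 < d := by positivity
  set A := 1 + 2 / (α * β)
  have hA : 0 < A := by positivity
  -- A positive replacement for g₁, still below 1, so that ln(1/g) ≥ ln(1/g₂) > 0 whenever 0 < g ≤
  -- g₁.
  set g₂ := max g₁ (1 / 2)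
  have hg₂ : 0 < g₂ := lt_max_of_lt_right (by norm_num)
  have hlog : 0 < Real.log (1 / g₂) :=
    Real.log_pos ((one_lt_div hg₂).2 (max_lt hg₁ (by norm_num)))
  -- The threshold g₀ = exp(-e) is where ln ln(1/g) reaches 1.
  refine ⟨A * Real.exp 1 / Real.log (1 / g₂), by positivity, d / τ, by positivity, τ * A / d,
    by positivity, Real.exp (-Real.exp 1), Real.exp_pos _, ?_⟩
  intro K h l xI G hexp hK hxI hR hG Ω _ P _ m hrun g hg hg0
  have hfail := fun n => hrun.measureReal_failure_le hα hα1 hβ hβ1 hW hexp hxI hK hG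
    (hR.trans (ENNReal.ofReal_le_ofReal (le_max_left V 1))) hg n
  have hdg : d * g ≤ 1 := (hfail 0).1.trans (by norm_num)
  have hdg0 : 0 < d * g := mul_pos hd hg0
  refine ⟨fun hle t ht => ?_, fun hle => ?_⟩
  · have hbound := exponentialConvergenceBound_of_geometric hτ hA.le hdg0.le hdg
      (fun n => (hfail n).2) t ht
    rw [mul_div_right_comm] at hbound
    refine hbound.trans ?_
    have : Real.log (1 / g₂) ≤ Real.log (1 / g) :=
      Real.log_le_log (by positivity) (one_div_le_one_div_of_le hg0 (hle.trans (le_max_left _ _)))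
    refine mul_le_mul_of_nonneg_right ?_ (Real.exp_pos _).le
    rw [div_mul_eq_mul_div, le_div_iff₀ hlog]
    gcongr
  · refine (lintegral_planningTime_le_of_geometric hG hrun.measurable hτ hA.le hdg0 hdg
      (fun n => (hfail n).2)).trans (ENNReal.ofReal_le_ofReal ?_)
    have h1 : Real.exp 1 ≤ Real.log (1 / g) := by
      rw [one_div, Real.log_inv, le_neg]
      exact (Real.log_le_log hg0 hle).trans_eq (Real.log_exp _)
    have h2 : 1 ≤ Real.log (Real.log (1 / g)) :=
      (Real.le_log_iff_exp_le ((Real.exp_pos 1).trans_le h1)).2 h1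
    calc τ * A / (d * g) = τ * A / d * (1 / g * 1) := by field_simp
      _ ≤ _ := by gcongr
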